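/- For an odd integer $m\ge 2$ and an integer $n$, let $Q_m(n)\in\{0,1,\dots,m-1\}$ be the Euler quotient: $Q_m(n)\equiv \frac{n^{\phi(m)}-1}{m} \pmod m$ if $\gcd(n,m)=1$, where $\phi$ is Euler's totient function, and $Q_m(n)=0$ if $\gcd(n,m)>1$. Let $p$ and $q$ be distinct odd primes with $p\mid (q-1)$, and define a binary sequence $(\widehat s_t)_{t\ge 0}$ by $\widehat s_t=0$ if $0\le \frac{Q_{pq}(t)}{pq}<\frac12$ and $\widehat s_t=1$ if $\frac12\le \frac{Q_{pq}(t)}{pq}<1$. Then $(\widehat s_t)$ is $pq^2$-periodic, that is, $\widehat s_{t+pq^2}=\widehat s_t$ for all $t\ge 0$, and $$\sum_{t=0}^{pq^2-1}(-1)^{\widehat s_t+\widehat s_{t+pq}+\widehat s_{t+2pq}+\widehat s_{t+3pq}}=\frac13\,pq^2+\frac23\,q^2+O\!\left(pq^{3/2}\,(\log (pq))^4\right),$$ where the implied constant is absolute, i.e. independent of $p$ and $q$. -/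

import Mathlib

/-- The Euler quotient `Q_m(n)`: for `gcd(n, m) = 1` it is the residue modulo `m`, taken in
`{0, …, m - 1}`, of the integer `(n ^ φ(m) - 1) / m` (the division is exact by Euler's theorem);
for `gcd(n, m) > 1` it is `0`. -/
def eulerQuotient (m : ℕ) (n : ℤ) : ℤ :=
  if Int.gcd n m = 1 then ((n ^ Nat.totient m - 1) / (m : ℤ)) % (m : ℤ) else 0

/-- The binary threshold sequence of the Euler quotient modulo `m`: its `t`-th term is `0` if
`0 ≤ Q_m(t) / m < 1 / 2` and `1` if `1 / 2 ≤ Q_m(t) / m < 1`. -/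
def eulerBinarySeq (m : ℕ) (t : ℕ) : ℕ :=
  if (eulerQuotient m (t : ℤ) : ℚ) / (m : ℚ) < 1 / 2 then 0 else 1

open Finset

/-! Since `p ∣ q - 1`, the power `t ^ φ(pq)` is `1` modulo `p²q`, so for `t` coprime to `pq` the
Euler quotient is `p * (R % q)` with `R = reducedQuotient p q t`, and the sign of the sequence is
`floorSign q (2 * R)`. Along `t, t + pq, t + 2pq, …` the residue of `R` modulo `q` is affine, with
step `c / t` for a constant `c ≠ 0` modulo `q` (`reducedQuotient_add`, `quotientStep_cast`). Summing
over such a progression therefore gives `signSum q b` with `b ≡ 2c / t`.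

As `t` runs over the units modulo `pq`, each nonzero `b` modulo `q` occurs `p - 1` times; non-units
contribute `1` per term. Hence the exact value `q² + (p - 1) ∑ signSum q b` (`sum_correlationTerm`).
Finally `signSum` is even and piecewise linear in `b`, so its sum is `q² / 3 + O(q)`. The resulting
error `O(pq)` needs no exponential sums and is stronger than the stated bound. -/

/-- The sign `(-1) ^ ⌊n / q⌋`. -/
def floorSign (q : ℕ) (n : ℤ) : ℤ := if Even (n / (q : ℤ)) then 1 else -1

/-- The product of the signs along a four-term arithmetic progression `u, u + b, u + 2b, u + 3b`. -/
def signProd (q : ℕ) (b u : ℤ) : ℤ :=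
  floorSign q u * floorSign q (u + b) * floorSign q (u + 2 * b) * floorSign q (u + 3 * b)

/-- The sum of `signProd` over a full period of the starting point. -/
def signSum (q : ℕ) (b : ℤ) : ℤ := ∑ u ∈ range q, signProd q b u

/-! ### Sums of periodic functions over residues -/

theorem sum_range_mul_eq {M : Type*} [AddCommMonoid M] (f : ℕ → M) (a b : ℕ) :
    ∑ t ∈ range (a * b), f t = ∑ l ∈ range a, ∑ i ∈ range b, f (i + b * l) := by
  induction a with
  | zero => simp
  | succ a ih =>
    rw [Nat.succ_mul, sum_range_add, ih, sum_range_succ]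
    congr 1
    exact sum_congr rfl fun i _ => by rw [add_comm, mul_comm a b]

theorem sum_range_natCast_zmod {M : Type*} [AddCommMonoid M] (q : ℕ) [NeZero q] (H : ZMod q → M) :
    ∑ x ∈ range q, H (x : ZMod q) = ∑ z : ZMod q, H z := by
  refine sum_bij (fun x _ => (x : ZMod q)) (fun _ _ => mem_univ _) ?_ ?_ (fun _ _ => rfl)
  · intro x hx y hy h
    rw [mem_range] at hx hy
    have := congrArg ZMod.val h
    rwa [ZMod.val_natCast_of_lt hx, ZMod.val_natCast_of_lt hy] at this
  · intro z _
    exact ⟨z.val, mem_range.2 (ZMod.val_lt z), by simp⟩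

theorem periodic_eq_val {M : Type*} {q : ℕ} [NeZero q] {h : ℤ → M}
    (hh : Function.Periodic h (q : ℤ)) (n : ℤ) : h n = h ((n : ZMod q).val : ℤ) := by
  rw [ZMod.val_intCast]
  conv_lhs => rw [← Int.emod_add_mul_ediv n q, mul_comm]
  simpa using hh.int_mul (n / q) (n % q)

theorem periodic_congr {M : Type*} {q : ℕ} [NeZero q] {h : ℤ → M}
    (hh : Function.Periodic h (q : ℤ)) {m n : ℤ} (e : (m : ZMod q) = n) : h m = h n := by
  rw [periodic_eq_val hh m, e, ← periodic_eq_val hh n]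

theorem sum_range_periodic_affine {M : Type*} [AddCommMonoid M] {q : ℕ} [Fact q.Prime] {h : ℤ → M}
    (hh : Function.Periodic h (q : ℤ)) {c : ℤ} (hc : (c : ZMod q) ≠ 0) (d : ℤ) :
    ∑ x ∈ range q, h (d + c * x) = ∑ x ∈ range q, h x := by
  have e1 : ∀ x : ℕ, h (d + c * x) = (fun z : ZMod q => h ((d + c * z : ZMod q).val : ℤ)) x := by
    intro x
    rw [periodic_eq_val hh]
    simp
  have e2 : ∀ x : ℕ, h (x : ℤ) = (fun z : ZMod q => h (z.val : ℤ)) x := by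
    intro x
    rw [periodic_eq_val hh]
    simp
  rw [sum_congr rfl fun x _ => e1 x, sum_congr rfl fun x _ => e2 x,
    sum_range_natCast_zmod q (fun z : ZMod q => h ((d + c * z : ZMod q).val : ℤ)),
    sum_range_natCast_zmod q (fun z : ZMod q => h (z.val : ℤ))]
  exact Fintype.sum_equiv ((Equiv.mulLeft₀ (c : ZMod q) hc).trans (Equiv.addLeft (d : ZMod q)))
    _ _ fun z => by simp

/-! ### Sign patterns of four-term progressions -/

section floorSign

variable {q : ℕ}

theorem floorSign_add (hq : 0 < q) (n : ℤ) : floorSign q (n + q) = -floorSign q n := by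
  unfold floorSign
  rw [Int.add_ediv_of_dvd_right (dvd_refl _), Int.ediv_self (by positivity)]
  by_cases h : Even (n / (q : ℤ)) <;> simp [h]

theorem floorSign_antiperiodic (hq : 0 < q) : Function.Antiperiodic (floorSign q) (q : ℤ) :=
  floorSign_add hq

theorem floorSign_two_mul (hq : 0 < q) (n : ℤ) :
    floorSign q (2 * n) = if 2 * (n % q) < q then 1 else -1 := by
  have e : 2 * n = 2 * (n % q) + (n / q) * (2 * q) := by
    linarith [Int.emod_add_mul_ediv n q]
  have hper : Function.Periodic (floorSign q) (2 * (q : ℤ)) :=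
    (floorSign_antiperiodic hq).periodic_two_mul
  have e' : floorSign q (2 * n) = floorSign q (2 * (n % q)) := by
    rw [e]
    simpa using hper.int_mul (n / q) (2 * (n % q))
  have hq' : (0 : ℤ) < q := by exact_mod_cast hq
  have h0 := Int.emod_nonneg n hq'.ne'
  have h1 := Int.emod_lt_of_pos n hq'
  rw [e', floorSign]
  split_ifs with ha hb hb
  · rfl
  · rw [show 2 * (n % (q : ℤ)) / q = 1 by
      rw [Int.ediv_eq_iff_of_pos hq']; constructor <;> linarith] at ha
    simp at ha
  · rw [Int.ediv_eq_zero_of_lt (by linarith) hb] at ha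
    simp at ha
  · rfl

theorem floorSign_of_lt {n : ℤ} (h0 : 0 ≤ n) (h1 : n < q) : floorSign q n = 1 := by
  simp [floorSign, Int.ediv_eq_zero_of_lt h0 h1]

theorem floorSign_of_le_of_lt {n : ℤ} (h0 : (q : ℤ) ≤ n) (h1 : n < 2 * q) :
    floorSign q n = -1 := by
  have h := floorSign_add (q := q) (by omega) (n - q)
  rw [floorSign_of_lt (n := n - q) (by omega) (by omega)] at h
  simpa using h

theorem floorSign_of_two_mul_le_of_lt {n : ℤ} (h0 : 2 * (q : ℤ) ≤ n) (h1 : n < 3 * q) :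
    floorSign q n = 1 := by
  have h := floorSign_add (q := q) (by omega) (n - q)
  rw [floorSign_of_le_of_lt (n := n - q) (by omega) (by omega)] at h
  simpa using h

/-- Shifting `b` by `q` flips only the factors at `u + b` and `u + 3b`, and the two flips cancel. -/
theorem signProd_periodic_left (hq : 0 < q) (u : ℤ) :
    Function.Periodic (fun b => signProd q b u) (q : ℤ) := by
  intro b
  have h := floorSign_add hq
  have e2 : floorSign q (u + 2 * (b + q)) = floorSign q (u + 2 * b) := by
    rw [show u + 2 * (b + (q : ℤ)) = u + 2 * b + q + q by ring, h, h, neg_neg]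
  have e3 : floorSign q (u + 3 * (b + q)) = -floorSign q (u + 3 * b) := by
    rw [show u + 3 * (b + (q : ℤ)) = u + 3 * b + q + q + q by ring, h, h, h, neg_neg]
  simp only [signProd]
  rw [e2, e3, ← add_assoc, h]
  ring

theorem signProd_periodic_right (hq : 0 < q) (b : ℤ) :
    Function.Periodic (signProd q b) (q : ℤ) := by
  intro u
  have h := floorSign_add hq
  simp only [signProd, add_right_comm u (q : ℤ), h]
  ring

theorem signSum_periodic (hq : 0 < q) : Function.Periodic (signSum q) (q : ℤ) := fun b =>
  sum_congr rfl fun u _ => signProd_periodic_left hq (u : ℤ) b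

theorem sum_signProd_affine [Fact q.Prime] (b : ℤ) {c : ℤ} (hc : (c : ZMod q) ≠ 0) (d : ℤ) :
    ∑ j ∈ range q, signProd q b (d + c * j) = signSum q b :=
  sum_range_periodic_affine (signProd_periodic_right (Fact.out : q.Prime).pos b) hc d

/-- Reversing the progression, i.e. starting at `u + 3b`, permutes the four factors. -/
theorem signSum_neg [Fact q.Prime] (b : ℤ) : signSum q (-b) = signSum q b := by
  rw [← sum_signProd_affine (-b) (c := 1) (by simp) (3 * b)]
  refine sum_congr rfl fun u _ => ?_
  simp only [signProd]
  rw [show 3 * b + 1 * (u : ℤ) = u + 3 * b by ring,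
    show (u : ℤ) + 3 * b + -b = u + 2 * b by ring,
    show (u : ℤ) + 3 * b + 2 * -b = u + b by ring,
    show (u : ℤ) + 3 * b + 3 * -b = u by ring]
  ring

theorem sum_range_const_of_forall {f : ℕ → ℤ} {n : ℕ} {c : ℤ} (h : ∀ i < n, f i = c) :
    ∑ i ∈ range n, f i = n * c := by
  rw [sum_congr rfl fun i hi => h i (mem_range.1 hi)]
  simp

/-- As `u` grows from `0` to `q`, the terms `u + 3b`, `u + 2b`, `u + b` cross `q` in turn, giving
blocks of lengths `q - 3b, b, b, b` with signs `+, -, +, -`. -/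
theorem signSum_of_three_mul_le {b : ℕ} (h : 3 * b ≤ q) : signSum q b = q - 4 * b := by
  obtain ⟨r, rfl⟩ := Nat.exists_eq_add_of_le' h
  rw [signSum]
  set q := r + 3 * b with hq
  have hs : range q = range (r + b + b + b) := by congr 1; omega
  rw [hs, sum_range_add, sum_range_add, sum_range_add,
    sum_range_const_of_forall (c := 1), sum_range_const_of_forall (c := -1),
    sum_range_const_of_forall (c := 1), sum_range_const_of_forall (c := -1)]
  · rw [hq]; push_cast; ring
  · intro i hi
    rw [signProd, floorSign_of_lt (by omega) (by omega), floorSign_of_le_of_lt (by omega) (by omega),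
      floorSign_of_le_of_lt (by omega) (by omega), floorSign_of_le_of_lt (by omega) (by omega)]
    norm_num
  · intro i hi
    rw [signProd, floorSign_of_lt (by omega) (by omega), floorSign_of_lt (by omega) (by omega),
      floorSign_of_le_of_lt (by omega) (by omega), floorSign_of_le_of_lt (by omega) (by omega)]
    norm_num
  · intro i hi
    rw [signProd, floorSign_of_lt (by omega) (by omega), floorSign_of_lt (by omega) (by omega),
      floorSign_of_lt (by omega) (by omega), floorSign_of_le_of_lt (by omega) (by omega)]
    norm_num
  · intro i hi
    rw [signProd, floorSign_of_lt (by omega) (by omega), floorSign_of_lt (by omega) (by omega),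
      floorSign_of_lt (by omega) (by omega), floorSign_of_lt (by omega) (by omega)]
    norm_num

theorem signSum_of_two_mul_le {b : ℕ} (h : 2 * b ≤ q) (h' : q ≤ 3 * b) :
    signSum q b = 8 * b - 3 * q := by
  rw [signSum]
  -- Here `u + 3b ≥ q` from the start; the sign changes as `u + 2b` and `u + b` cross `q`, and then
  -- as `u + 3b` crosses `2q`.
  have hs : range q = range ((q - 2 * b) + b + (q - 2 * b) + (3 * b - q)) := by congr 1; omega
  rw [hs, sum_range_add, sum_range_add, sum_range_add,
    sum_range_const_of_forall (c := -1), sum_range_const_of_forall (c := 1),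
    sum_range_const_of_forall (c := -1), sum_range_const_of_forall (c := 1)]
  · rw [Nat.cast_sub h, Nat.cast_sub h']; push_cast; ring
  · intro i hi
    rw [signProd, floorSign_of_lt (by omega) (by omega), floorSign_of_le_of_lt (by omega) (by omega),
      floorSign_of_le_of_lt (by omega) (by omega),
      floorSign_of_two_mul_le_of_lt (by omega) (by omega)]
    norm_num
  · intro i hi
    rw [signProd, floorSign_of_lt (by omega) (by omega), floorSign_of_le_of_lt (by omega) (by omega),
      floorSign_of_le_of_lt (by omega) (by omega), floorSign_of_le_of_lt (by omega) (by omega)]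
    norm_num
  · intro i hi
    rw [signProd, floorSign_of_lt (by omega) (by omega), floorSign_of_lt (by omega) (by omega),
      floorSign_of_le_of_lt (by omega) (by omega), floorSign_of_le_of_lt (by omega) (by omega)]
    norm_num
  · intro i hi
    rw [signProd, floorSign_of_lt (by omega) (by omega), floorSign_of_lt (by omega) (by omega),
      floorSign_of_lt (by omega) (by omega), floorSign_of_le_of_lt (by omega) (by omega)]
    norm_num

theorem signSum_zero : signSum q 0 = q := by
  simpa using signSum_of_three_mul_le (q := q) (b := 0) (by simp)

theorem two_mul_sum_range_linear (A B : ℤ) (n : ℕ) :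
    2 * ∑ b ∈ range n, (A + B * b) = 2 * n * A + B * n * (n - 1) := by
  induction n with
  | zero => simp
  | succ n ih => rw [sum_range_succ, mul_add, ih]; push_cast; ring

/-- Folding the sum over a period by the symmetry `b ↦ -b`. -/
theorem sum_signSum_fold [Fact q.Prime] {k : ℕ} (hk : q = 2 * k + 1) :
    ∑ b ∈ range q, signSum q b = 2 * ∑ b ∈ range (k + 1), signSum q b - q := by
  have hs : range q = range (k + 1 + k) := by congr 1; omega
  have h1 : ∑ x ∈ range k, signSum q ((k + 1 + x : ℕ) : ℤ)
      = ∑ x ∈ range k, signSum q ((x + 1 : ℕ) : ℤ) := by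
    rw [← sum_range_reflect (fun x : ℕ => signSum q ((x + 1 : ℕ) : ℤ))]
    refine sum_congr rfl fun x hx => ?_
    rw [mem_range] at hx
    have hp := signSum_periodic (Fact.out : q.Prime).pos (-((k - 1 - x + 1 : ℕ) : ℤ))
    rw [signSum_neg] at hp
    rw [← hp]
    congr 1
    omega
  rw [hs, sum_range_add, h1]
  have h2 := sum_range_succ' (fun x : ℕ => signSum q (x : ℤ)) k
  have h0 : signSum q ((0 : ℕ) : ℤ) = q := by simpa using signSum_zero (q := q)
  rw [h0] at h2
  linarith

theorem abs_three_mul_sum_signSum_sub_le [Fact q.Prime] (h2 : q ≠ 2) (h3 : q ≠ 3) :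
    |3 * ∑ b ∈ range q, signSum q b - (q : ℤ) ^ 2| ≤ 30 * (q : ℤ) := by
  have hq : q.Prime := Fact.out
  have hodd := hq.eq_two_or_odd.resolve_left h2
  have hm3 : q % 3 ≠ 0 := fun h =>
    h3 ((Nat.prime_dvd_prime_iff_eq Nat.prime_three hq).1 (Nat.dvd_of_mod_eq_zero h)).symm
  have hmod : q % 6 = 1 ∨ q % 6 = 5 := by omega
  -- `n₁` counts the `b ≥ 0` with `3b ≤ q`, and `n₂` the remaining `b ≤ (q - 1) / 2`.
  obtain ⟨j, n₁, n₂, hn⟩ : ∃ j n₁ n₂ : ℕ, (q = 6 * j + 1 ∧ n₁ = 2 * j + 1 ∧ n₂ = j) ∨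
      (q = 6 * j + 5 ∧ n₁ = 2 * j + 2 ∧ n₂ = j + 1) := by
    rcases hmod with h | h
    · exact ⟨q / 6, _, _, Or.inl ⟨by omega, rfl, rfl⟩⟩
    · exact ⟨q / 6, _, _, Or.inr ⟨by omega, rfl, rfl⟩⟩
  have hfold := sum_signSum_fold (q := q) (k := n₁ + n₂ - 1) (by omega)
  rw [show n₁ + n₂ - 1 + 1 = n₁ + n₂ by omega, sum_range_add] at hfold
  have e1 : ∑ x ∈ range n₁, signSum q (x : ℤ) = ∑ x ∈ range n₁, ((q : ℤ) + -4 * x) := by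
    refine sum_congr rfl fun x hx => ?_
    rw [mem_range] at hx
    rw [signSum_of_three_mul_le (by omega)]
    ring
  have e2 : ∑ x ∈ range n₂, signSum q ((n₁ + x : ℕ) : ℤ)
      = ∑ x ∈ range n₂, ((8 * n₁ - 3 * q : ℤ) + 8 * x) := by
    refine sum_congr rfl fun x hx => ?_
    rw [mem_range] at hx
    rw [signSum_of_two_mul_le (by omega) (by omega)]
    push_cast
    ring
  rw [e1, e2, mul_add, two_mul_sum_range_linear, two_mul_sum_range_linear] at hfold
  rw [hfold, abs_le]
  rcases hn with ⟨h, h', h''⟩ | ⟨h, h', h''⟩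
  all_goals
    rw [h, h', h'']
    push_cast
    constructor <;> nlinarith

end floorSign

/-! ### Euler quotients modulo `pq` -/

theorem exists_add_pow_eq {R : Type*} [CommSemiring R] (x y : R) (n : ℕ) :
    ∃ z, (x + y) ^ n = x ^ n + n * x ^ (n - 1) * y + z * y ^ 2 :=
  ⟨_, (Polynomial.powAddExpansion x y n).2⟩

/-- The integer `(t ^ φ(pq) - 1) / (p ^ 2 q)`; the division is exact when `p ∣ q - 1` and `t` is
coprime to `pq`, and then `p` times its residue modulo `q` is the Euler quotient modulo `pq`. -/
def reducedQuotient (p q t : ℕ) : ℤ :=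
  ((t : ℤ) ^ Nat.totient (p * q) - 1) / ((p : ℤ) ^ 2 * q)

/-- The common difference of `reducedQuotient p q` modulo `q` along `t, t + pq, t + 2pq, …`. -/
def quotientStep (p q t : ℕ) : ℤ :=
  ((p : ℤ) - 1) * ((q - 1) / p : ℕ) * (t : ℤ) ^ (Nat.totient (p * q) - 1)

theorem gcd_natCast_mul_eq_one_iff {t m : ℕ} : Int.gcd (t : ℤ) (m : ℤ) = 1 ↔ t.Coprime m := by
  rw [Int.gcd_natCast_natCast, Nat.Coprime]

section

variable {p q : ℕ}

theorem totient_mul_primes (hp : p.Prime) (hq : q.Prime) (hpq : p ≠ q) :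
    Nat.totient (p * q) = (p - 1) * (q - 1) := by
  rw [Nat.totient_mul ((Nat.coprime_primes hp hq).2 hpq), Nat.totient_prime hp,
    Nat.totient_prime hq]

theorem natCast_dvd_pow_sub_one {t n e : ℕ} (h : t.Coprime n) (he : Nat.totient n ∣ e) :
    (n : ℤ) ∣ (t : ℤ) ^ e - 1 := by
  obtain ⟨c, rfl⟩ := he
  have := ((Nat.ModEq.pow_totient h).pow c).symm
  rw [one_pow, ← pow_mul] at this
  simpa using (Nat.modEq_iff_dvd.1 this)

/-- The extra factor `p` arises because `φ(p²) = p(p - 1)` divides `(p - 1)(q - 1)`. -/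
theorem sq_mul_dvd_pow_totient_sub_one (hp : p.Prime) (hq : q.Prime) (hpq : p ≠ q)
    (h : p ∣ q - 1) {t : ℕ} (ht : t.Coprime (p * q)) :
    (p : ℤ) ^ 2 * q ∣ (t : ℤ) ^ Nat.totient (p * q) - 1 := by
  rw [totient_mul_primes hp hq hpq]
  rw [Nat.coprime_mul_iff_right] at ht
  have hcop : IsCoprime ((p : ℤ) ^ 2) (q : ℤ) := by
    have := (Nat.isCoprime_iff_coprime.2 ((Nat.coprime_primes hp hq).2 hpq))
    exact this.pow_left
  refine hcop.mul_dvd ?_ ?_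
  · have := natCast_dvd_pow_sub_one (n := p ^ 2) (e := (p - 1) * (q - 1)) (ht.1.pow_right 2) (by
      rw [Nat.totient_prime_pow hp two_pos, mul_comm]
      simpa using Nat.mul_dvd_mul_left (p - 1) h)
    simpa using this
  · exact natCast_dvd_pow_sub_one ht.2 (by rw [Nat.totient_prime hq]; exact dvd_mul_left _ _)

theorem pow_totient_eq (hp : p.Prime) (hq : q.Prime) (hpq : p ≠ q)
    (h : p ∣ q - 1) {t : ℕ} (ht : t.Coprime (p * q)) :
    (t : ℤ) ^ Nat.totient (p * q) = 1 + (p : ℤ) ^ 2 * q * reducedQuotient p q t := by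
  rw [reducedQuotient, Int.mul_ediv_cancel' (sq_mul_dvd_pow_totient_sub_one hp hq hpq h ht)]
  ring

theorem coprime_add_mul (t k m : ℕ) : (t + k * m).Coprime m ↔ t.Coprime m := by simp

/-- Expand `(t + kpq) ^ φ(pq)` to second order and divide by `p²q`: the linear term stays integral
because `p ∣ φ(pq)`, and the remainder `z(kpq)²` leaves a multiple of `q`. -/
theorem reducedQuotient_add (hp : p.Prime) (hq : q.Prime) (hpq : p ≠ q)
    (h : p ∣ q - 1) {t : ℕ} (ht : t.Coprime (p * q)) (k : ℕ) :
    ((reducedQuotient p q (t + k * (p * q)) : ℤ) : ZMod q)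
      = ((reducedQuotient p q t + k * quotientStep p q t : ℤ) : ZMod q) := by
  have e1 := pow_totient_eq hp hq hpq h ht
  have e2 := pow_totient_eq hp hq hpq h ((coprime_add_mul t k (p * q)).2 ht)
  obtain ⟨z, hz⟩ := exists_add_pow_eq (t : ℤ) (k * (p * q)) (Nat.totient (p * q))
  push_cast at e2
  rw [hz, e1] at e2
  obtain ⟨w, hw⟩ := h
  have hw' : (q - 1) / p = w := by rw [hw, Nat.mul_div_cancel_left _ hp.pos]
  have hφ : ((Nat.totient (p * q) : ℕ) : ℤ) = (p - 1) * (p * w) := by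
    rw [totient_mul_primes hp hq hpq, hw]
    push_cast [Nat.cast_sub hp.one_le]
    ring
  have hp0 : (p : ℤ) ≠ 0 := by exact_mod_cast hp.ne_zero
  have hq0 : (q : ℤ) ≠ 0 := by exact_mod_cast hq.ne_zero
  have key : reducedQuotient p q (t + k * (p * q))
      = reducedQuotient p q t + k * quotientStep p q t + q * (z * k ^ 2) := by
    have : (p : ℤ) ^ 2 * q ≠ 0 := by positivity
    apply mul_left_cancel₀ this
    rw [hφ] at e2
    rw [quotientStep, hw']
    linear_combination -e2
  rw [key]
  simp

theorem eulerQuotient_eq (hp : p.Prime) (hq : q.Prime) (hpq : p ≠ q)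
    (h : p ∣ q - 1) {t : ℕ} (ht : t.Coprime (p * q)) :
    eulerQuotient (p * q) t = p * (reducedQuotient p q t % q) := by
  have hp0 : (0 : ℤ) < p := by exact_mod_cast hp.pos
  have hq0 : (0 : ℤ) < q := by exact_mod_cast hq.pos
  rw [eulerQuotient, if_pos (gcd_natCast_mul_eq_one_iff.2 ht), pow_totient_eq hp hq hpq h ht]
  rw [show (1 + (p : ℤ) ^ 2 * q * reducedQuotient p q t - 1)
    = ((p * q : ℕ) : ℤ) * (p * reducedQuotient p q t) by push_cast; ring,
    Int.mul_ediv_cancel_left _ (by push_cast; positivity)]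
  push_cast
  exact Int.mul_emod_mul_of_pos _ _ hp0

theorem eulerBinarySeq_of_not_coprime {m t : ℕ} (ht : ¬ t.Coprime m) :
    eulerBinarySeq m t = 0 := by
  rw [eulerBinarySeq, eulerQuotient, if_neg (mt gcd_natCast_mul_eq_one_iff.1 ht)]
  norm_num

theorem eulerBinarySeq_of_coprime (hp : p.Prime) (hq : q.Prime) (hpq : p ≠ q)
    (h : p ∣ q - 1) {t : ℕ} (ht : t.Coprime (p * q)) :
    eulerBinarySeq (p * q) t = if 2 * (reducedQuotient p q t % q) < q then 0 else 1 := by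
  have hp0 : (0 : ℚ) < p := by exact_mod_cast hp.pos
  have hq0 : (0 : ℚ) < q := by exact_mod_cast hq.pos
  rw [eulerBinarySeq, eulerQuotient_eq hp hq hpq h ht]
  push_cast
  refine if_congr ?_ rfl rfl
  rw [mul_div_mul_left _ _ hp0.ne', div_lt_div_iff₀ hq0 two_pos, one_mul, mul_comm]
  exact_mod_cast Iff.rfl

theorem neg_one_pow_eulerBinarySeq (hp : p.Prime) (hq : q.Prime) (hpq : p ≠ q)
    (h : p ∣ q - 1) {t : ℕ} (ht : t.Coprime (p * q)) :
    (-1 : ℤ) ^ eulerBinarySeq (p * q) t = floorSign q (2 * reducedQuotient p q t) := by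
  rw [floorSign_two_mul hq.pos, eulerBinarySeq_of_coprime hp hq hpq h ht]
  split_ifs <;> simp

theorem eulerBinarySeq_periodic (hp : p.Prime) (hq : q.Prime) (hpq : p ≠ q) (h : p ∣ q - 1) :
    Function.Periodic (eulerBinarySeq (p * q)) (p * q ^ 2) := by
  intro t
  rw [show p * q ^ 2 = q * (p * q) by ring]
  by_cases ht : t.Coprime (p * q)
  · have ht' := (coprime_add_mul t q (p * q)).2 ht
    have e := reducedQuotient_add hp hq hpq h ht q
    rw [eulerBinarySeq_of_coprime hp hq hpq h ht, eulerBinarySeq_of_coprime hp hq hpq h ht']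
    rw [(ZMod.intCast_eq_intCast_iff' _ _ q).1 e]
    simp
  · rw [eulerBinarySeq_of_not_coprime ht,
      eulerBinarySeq_of_not_coprime (mt (coprime_add_mul t q (p * q)).1 ht)]

theorem floorSign_two_mul_congr (hq : 0 < q) {x y : ℤ} (e : (x : ZMod q) = y) :
    floorSign q (2 * x) = floorSign q (2 * y) := by
  rw [floorSign_two_mul hq, floorSign_two_mul hq, (ZMod.intCast_eq_intCast_iff' _ _ q).1 e]

/-! ### Evaluation of the correlation sum -/

/-- The correlation term `(-1) ^ (s t + s (t + m) + s (t + 2 m) + s (t + 3 m))`. -/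
def correlationTerm (m t : ℕ) : ℤ :=
  (-1) ^ (eulerBinarySeq m t + eulerBinarySeq m (t + m) + eulerBinarySeq m (t + 2 * m)
    + eulerBinarySeq m (t + 3 * m))

theorem correlationTerm_of_coprime (hp : p.Prime) (hq : q.Prime) (hpq : p ≠ q)
    (h : p ∣ q - 1) {r : ℕ} (hr : r.Coprime (p * q)) (j : ℕ) :
    correlationTerm (p * q) (r + p * q * j) = signProd q (2 * quotientStep p q r)
      (2 * reducedQuotient p q r + 2 * quotientStep p q r * j) := by
  have key : ∀ k : ℕ, (-1 : ℤ) ^ eulerBinarySeq (p * q) (r + p * q * j + k * (p * q)) =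
      floorSign q (2 * (reducedQuotient p q r + (j + k) * quotientStep p q r)) := by
    intro k
    rw [show r + p * q * j + k * (p * q) = r + (j + k) * (p * q) by ring,
      neg_one_pow_eulerBinarySeq hp hq hpq h ((coprime_add_mul _ _ _).2 hr)]
    apply floorSign_two_mul_congr hq.pos
    rw [reducedQuotient_add hp hq hpq h hr]
    push_cast
    rfl
  have k0 := key 0
  have k1 := key 1
  have k2 := key 2
  have k3 := key 3
  rw [zero_mul, add_zero] at k0
  rw [one_mul] at k1
  rw [correlationTerm, pow_add, pow_add, pow_add, k0, k1, k2, k3, signProd]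
  congr 1
  · congr 1
    · congr 1 <;> congr 1 <;> push_cast <;> ring
    · congr 1; push_cast; ring
  · congr 1; push_cast; ring

theorem correlationTerm_of_not_coprime {m r : ℕ} (hr : ¬ r.Coprime m) (j : ℕ) :
    correlationTerm m (r + m * j) = 1 := by
  have key : ∀ k : ℕ, eulerBinarySeq m (r + m * j + k * m) = 0 := by
    intro k
    rw [show r + m * j + k * m = r + (j + k) * m by ring]
    exact eulerBinarySeq_of_not_coprime (mt (coprime_add_mul _ _ _).1 hr)
  have k0 := key 0
  have k1 := key 1
  rw [zero_mul, add_zero] at k0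
  rw [one_mul] at k1
  simp [correlationTerm, k0, k1, key 2, key 3]

theorem quotientStep_cast (hp : p.Prime) (hq : q.Prime) (hpq : p ≠ q) (hp2 : p ≠ 2) (hq2 : q ≠ 2)
    (t : ℕ) : ((quotientStep p q t : ℤ) : ZMod q)
      = ((p : ZMod q) - 1) * ((q - 1) / p : ℕ) * (t : ZMod q)⁻¹ := by
  have := Fact.mk hq
  have hp1 : 2 < p := lt_of_le_of_ne hp.two_le hp2.symm
  have hq1 : 2 < q := lt_of_le_of_ne hq.two_le hq2.symm
  have hφ : 1 < (p - 1) * (q - 1) := Nat.one_lt_mul_iff.2 ⟨by omega, by omega, by omega⟩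
  rw [quotientStep, Int.cast_mul, Int.cast_mul, Int.cast_natCast, Int.cast_sub, Int.cast_natCast,
    Int.cast_one, Int.cast_pow, Int.cast_natCast]
  congr 1
  rw [totient_mul_primes hp hq hpq]
  rcases eq_or_ne (t : ZMod q) 0 with h0 | h0
  -- The convention `0⁻¹ = 0` agrees with `0 ^ (φ(pq) - 1) = 0`, so the formula holds for every `t`.
  · rw [h0, zero_pow (by omega), inv_zero]
  · refine eq_inv_of_mul_eq_one_left ?_
    rw [← pow_succ, Nat.sub_add_cancel hφ.le, mul_comm (p - 1), pow_mul,
      ZMod.pow_card_sub_one_eq_one h0, one_pow]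

theorem two_mul_step_ne_zero (hp : p.Prime) (hq : q.Prime) (hp2 : p ≠ 2) (hq2 : q ≠ 2)
    (h : p ∣ q - 1) : (2 * (((p : ZMod q) - 1) * ((q - 1) / p : ℕ))) ≠ 0 := by
  have := Fact.mk hq
  have hp1 : 2 < p := lt_of_le_of_ne hp.two_le hp2.symm
  have hq1 : 2 < q := lt_of_le_of_ne hq.two_le hq2.symm
  have hle : p ≤ q - 1 := Nat.le_of_dvd (by omega) h
  have small : ∀ n : ℕ, 0 < n → n < q → (n : ZMod q) ≠ 0 := fun n h0 h1 e =>
    absurd (Nat.le_of_dvd h0 ((ZMod.natCast_eq_zero_iff n q).1 e)) (by omega)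
  refine mul_ne_zero (by simpa using small 2 two_pos hq1) (mul_ne_zero ?_ ?_)
  · have := small (p - 1) (by omega) (by omega)
    rwa [Nat.cast_sub hp.one_le, Nat.cast_one] at this
  · exact small _ (Nat.div_pos hle hp.pos)
      (lt_of_le_of_lt (Nat.div_le_self _ _) (by omega))

/-- Modulo `q`, the map `z ↦ c * z⁻¹` is a bijection of all residues, `0` included. -/
theorem sum_signSum_quotientStep (hp : p.Prime) (hq : q.Prime) (hpq : p ≠ q) (hp2 : p ≠ 2)
    (hq2 : q ≠ 2) (h : p ∣ q - 1) :
    ∑ i ∈ range q, signSum q (2 * quotientStep p q i) = ∑ b ∈ range q, signSum q b := by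
  have := Fact.mk hq
  have hper := signSum_periodic hq.pos
  set c : ZMod q := 2 * (((p : ZMod q) - 1) * ((q - 1) / p : ℕ)) with hc
  have hc0 : c ≠ 0 := two_mul_step_ne_zero hp hq hp2 hq2 h
  have e1 : ∀ i : ℕ, signSum q (2 * quotientStep p q i)
      = (fun z : ZMod q => signSum q ((c * z⁻¹).val : ℤ)) i := by
    intro i
    rw [periodic_eq_val hper, Int.cast_mul, quotientStep_cast hp hq hpq hp2 hq2]
    simp [hc, mul_assoc]
  have e2 : ∀ i : ℕ, signSum q i = (fun z : ZMod q => signSum q (z.val : ℤ)) i := by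
    intro i
    rw [periodic_eq_val hper]
    simp
  rw [sum_congr rfl fun x _ => e1 x, sum_congr rfl fun x _ => e2 x,
    sum_range_natCast_zmod q (fun z : ZMod q => signSum q ((c * z⁻¹).val : ℤ)),
    sum_range_natCast_zmod q (fun z : ZMod q => signSum q (z.val : ℤ))]
  exact Fintype.sum_equiv ((inv_involutive.toPerm _).trans (Equiv.mulLeft₀ c hc0))
    _ _ fun z => by simp

theorem sum_range_ite_not_dvd_affine [Fact p.Prime] {a : ℤ} (ha : (a : ZMod p) ≠ 0) (d c : ℤ) :
    ∑ l ∈ range p, (if (p : ℤ) ∣ d + a * l then 0 else c) = ((p : ℤ) - 1) * c := by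
  have hp := (Fact.out : p.Prime)
  have hper : Function.Periodic (fun n : ℤ => if (p : ℤ) ∣ n then 0 else c) (p : ℤ) := by
    intro n
    simp only [dvd_add_self_right]
  rw [sum_range_periodic_affine hper ha d]
  have e : ∀ l ∈ range p, (if (p : ℤ) ∣ (l : ℤ) then 0 else c) = c - if l = 0 then c else 0 := by
    intro l hl
    rw [mem_range] at hl
    rcases Nat.eq_zero_or_pos l with rfl | h0
    · simp
    · have : ¬ (p : ℤ) ∣ l := by
        rw [Int.natCast_dvd_natCast]
        exact fun h' => absurd (Nat.le_of_dvd h0 h') (by omega)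
      simp [this, h0.ne']
  rw [sum_congr rfl e, sum_sub_distrib, sum_ite_eq', if_pos (mem_range.2 hp.pos)]
  simp
  ring

/-- The exact value of the fourth order correlation sum. -/
theorem sum_correlationTerm (hp : p.Prime) (hq : q.Prime) (hpq : p ≠ q) (hp2 : p ≠ 2)
    (hq2 : q ≠ 2) (h : p ∣ q - 1) :
    ∑ t ∈ range (p * q ^ 2), correlationTerm (p * q) t
      = (q : ℤ) ^ 2 + (p - 1) * ∑ b ∈ range q, signSum q b := by
  have := Fact.mk hq
  have := Fact.mk hp
  have hcop := (Nat.coprime_primes hp hq).2 hpq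
  have hper := signSum_periodic hq.pos
  have hstep0 : ∀ r : ℕ, (r : ZMod q) = 0 → signSum q (2 * quotientStep p q r) = q := by
    intro r hr
    rw [← signSum_zero (q := q)]
    apply periodic_congr hper
    rw [Int.cast_mul, quotientStep_cast hp hq hpq hp2 hq2, hr]
    simp
  have inner : ∀ r : ℕ, ∑ j ∈ range q, correlationTerm (p * q) (r + p * q * j)
      = q + if r.Coprime (p * q) then signSum q (2 * quotientStep p q r) - q else 0 := by
    intro r
    split_ifs with hr
    · rw [sum_congr rfl fun j _ => correlationTerm_of_coprime hp hq hpq h hr j,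
        sum_signProd_affine]
      · ring
      · have hr' : (r : ZMod q) ≠ 0 := by
          intro e
          rw [ZMod.natCast_eq_zero_iff] at e
          exact Nat.Prime.coprime_iff_not_dvd hq |>.1 (Nat.coprime_mul_iff_right.1 hr).2.symm e
        rw [Int.cast_mul, quotientStep_cast hp hq hpq hp2 hq2, ← mul_assoc]
        exact mul_ne_zero (by exact_mod_cast two_mul_step_ne_zero hp hq hp2 hq2 h) (inv_ne_zero hr')
    · rw [sum_congr rfl fun j _ => correlationTerm_of_not_coprime hr j]
      simp
  -- Among the lifts `i + ql` of a nonzero residue `i`, exactly `p - 1` are prime to `p`. For `i ≡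
  -- 0` no lift is a unit, but both sides vanish since `signSum q 0 = q`.
  have outer : ∀ i : ℕ, ∑ l ∈ range p, (if (i + q * l).Coprime (p * q) then
      signSum q (2 * quotientStep p q (i + q * l)) - q else 0)
      = ((p : ℤ) - 1) * (signSum q (2 * quotientStep p q i) - q) := by
    intro i
    have hcast : ∀ l : ℕ, ((i + q * l : ℕ) : ZMod q) = i := by simp
    rcases eq_or_ne (i : ZMod q) 0 with hi | hi
    · rw [hstep0 i hi]
      have : ∀ l ∈ range p, (if (i + q * l).Coprime (p * q) then
          signSum q (2 * quotientStep p q (i + q * l)) - q else 0) = 0 := by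
        intro l _
        rw [hstep0 _ ((hcast l).trans hi)]
        simp
      rw [sum_congr rfl this]
      simp
    · have hq' : ((q : ℤ) : ZMod p) ≠ 0 := by
        rw [Int.cast_natCast, Ne, ZMod.natCast_eq_zero_iff]
        exact (Nat.Prime.coprime_iff_not_dvd hp).1 hcop
      rw [← sum_range_ite_not_dvd_affine hq' i]
      refine sum_congr rfl fun l _ => ?_
      have e1 : signSum q (2 * quotientStep p q (i + q * l)) = signSum q (2 * quotientStep p q i) := by
        apply periodic_congr hper
        rw [Int.cast_mul, Int.cast_mul, quotientStep_cast hp hq hpq hp2 hq2,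
          quotientStep_cast hp hq hpq hp2 hq2, hcast]
      have e2 : (i + q * l).Coprime (p * q) ↔ ¬ (p : ℤ) ∣ (i : ℤ) + (q : ℤ) * l := by
        have : (i + q * l).Coprime q := by
          rw [Nat.coprime_comm, Nat.Prime.coprime_iff_not_dvd hq, ← ZMod.natCast_eq_zero_iff, hcast]
          exact hi
        rw [Nat.coprime_mul_iff_right, and_iff_left this, Nat.coprime_comm,
          Nat.Prime.coprime_iff_not_dvd hp, ← Int.natCast_dvd_natCast]
        push_cast
        rfl
      rw [e1]
      by_cases h' : (p : ℤ) ∣ (i : ℤ) + (q : ℤ) * l <;> simp [e2, h']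
  rw [show p * q ^ 2 = q * (p * q) by ring, sum_range_mul_eq, sum_comm,
    sum_congr rfl fun r _ => inner r, sum_add_distrib, sum_range_mul_eq
      (fun r => if r.Coprime (p * q) then signSum q (2 * quotientStep p q r) - q else 0), sum_comm,
    sum_congr rfl fun i _ => outer i, ← mul_sum, sum_sub_distrib,
    sum_signSum_quotientStep hp hq hpq hp2 hq2 h]
  simp
  ring

end

/-! ### The asymptotic formula -/

theorem corollary2 :
    ∃ C : ℝ, 0 < C ∧ ∀ p q : ℕ, p.Prime → q.Prime → p ≠ 2 → q ≠ 2 → p ≠ q → p ∣ q - 1 →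
      Function.Periodic (eulerBinarySeq (p * q)) (p * q ^ 2) ∧
      |(∑ t ∈ Finset.range (p * q ^ 2),
            (-1 : ℝ) ^ (eulerBinarySeq (p * q) t + eulerBinarySeq (p * q) (t + p * q)
              + eulerBinarySeq (p * q) (t + 2 * (p * q))
              + eulerBinarySeq (p * q) (t + 3 * (p * q))))
          - (1 / 3 * (p : ℝ) * (q : ℝ) ^ 2 + 2 / 3 * (q : ℝ) ^ 2)|
        ≤ C * ((p : ℝ) * (q : ℝ) ^ (3 / 2 : ℝ) * Real.log ((p : ℝ) * (q : ℝ)) ^ 4) := by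
  -- The constant `10` is `30 / 3`, from the bound `30 * q` in `abs_three_mul_sum_signSum_sub_le`.
  refine ⟨10, by norm_num, fun p q hp hq hp2 hq2 hpq h => ⟨eulerBinarySeq_periodic hp hq hpq h, ?_⟩⟩
  have := Fact.mk hq
  have hp3 : 3 ≤ p := lt_of_le_of_ne hp.two_le hp2.symm
  have hle : p ≤ q - 1 := Nat.le_of_dvd (by have := hq.two_le; omega) h
  have hS := abs_three_mul_sum_signSum_sub_le (q := q) hq2 (by omega)
  have hZ := sum_correlationTerm hp hq hpq hp2 hq2 h
  set S := ∑ b ∈ range q, signSum q b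
  have hsum : (∑ t ∈ Finset.range (p * q ^ 2),
            (-1 : ℝ) ^ (eulerBinarySeq (p * q) t + eulerBinarySeq (p * q) (t + p * q)
              + eulerBinarySeq (p * q) (t + 2 * (p * q))
              + eulerBinarySeq (p * q) (t + 3 * (p * q)))) = (q : ℝ) ^ 2 + (p - 1) * (S : ℝ) := by
    have := congrArg (Int.cast : ℤ → ℝ) hZ
    simpa [correlationTerm] using this
  have hS' : |3 * (S : ℝ) - (q : ℝ) ^ 2| ≤ 30 * (q : ℝ) := by exact_mod_cast hS
  have hp3' : (3 : ℝ) ≤ p := by exact_mod_cast hp3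
  have hq3' : (3 : ℝ) ≤ q := by exact_mod_cast (show 3 ≤ q by omega)
  have hlog : 1 ≤ Real.log ((p : ℝ) * q) := by
    rw [Real.le_log_iff_exp_le (by positivity)]
    nlinarith [Real.exp_one_lt_d9]
  have hpow : (q : ℝ) ≤ (q : ℝ) ^ (3 / 2 : ℝ) := by
    conv_lhs => rw [← Real.rpow_one (q : ℝ)]
    exact Real.rpow_le_rpow_of_exponent_le (by linarith) (by norm_num)
  rw [hsum]
  calc _ = ((p : ℝ) - 1) / 3 * |3 * (S : ℝ) - (q : ℝ) ^ 2| := by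
        rw [← abs_of_nonneg (show (0 : ℝ) ≤ ((p : ℝ) - 1) / 3 by linarith), ← abs_mul]
        congr 1
        ring
    _ ≤ p / 3 * (30 * q) := by gcongr; linarith
    _ = 10 * (p * q * 1) := by ring
    _ ≤ _ := by
        gcongr
        exact one_le_pow₀ hlog
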